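/- Let $q$ be an indeterminate. For a nonnegative integer $r$ put $[r]=(1-q^r)/(1-q)$, let $(x;q^3)_k=\prod_{i=0}^{k-1}(1-xq^{3i})$, and let $\Phi_n(q)$ be the $n$-th cyclotomic polynomial in $q$. For rational functions $A,B\in\mathbb{Q}(q)$ and a polynomial $P\in\mathbb{Q}[q]$, write $A\equiv B\pmod{P}$ if $P$ divides, in $\mathbb{Q}[q]$, the numerator of $A-B$ written in lowest terms. Let $n$ be a positive integer with $n\equiv 1\pmod 3$, and let $M=(n-1)/3$ or $M=n-1$. Then, modulo $[n]\Phi_n(q)^4$, $$\sum_{k=0}^{M}[6k+1]\frac{(q;q^3)_k^6}{(q^3;q^3)_k^6}\,q^{3k}\equiv[n]\,\frac{(q^2;q^3)_{(n-1)/3}^3}{(q^3;q^3)_{(n-1)/3}^3}\left\{1+[n]^2(2-q^{n})\sum_{j=1}^{(n-1)/3}\left(\frac{q^{3j-1}}{[3j-1]^2}-\frac{q^{3j}}{[3j]^2}\right)\right\}.$$ -/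

import Mathlib

namespace QSuper

open Polynomial

/-- The `q`-shifted factorial `(x; q)_k = (1 - x)(1 - x q) ⋯ (1 - x q^(k-1))`. -/
def qPoch {K : Type*} [CommRing K] (x q : K) (k : ℕ) : K :=
  ∏ i ∈ Finset.range k, (1 - x * q ^ i)

/-- The indeterminate `q` of the field `ℚ(q)` of rational functions. -/
noncomputable def q : RatFunc ℚ := RatFunc.X

/-- The `q`-integer `[r] = (1 - q^r) / (1 - q)` in `ℚ(q)`. -/
noncomputable def qInt (r : ℕ) : RatFunc ℚ := (1 - q ^ r) / (1 - q)

/-- The `q`-integer `[r] = 1 + q + ⋯ + q^(r-1)` as an element of `ℚ[q]`. -/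
noncomputable def qIntPoly (r : ℕ) : ℚ[X] := ∑ i ∈ Finset.range r, X ^ i

/-- The polynomial and the rational function `[r]` agree. -/
theorem algebraMap_qIntPoly (r : ℕ) :
    algebraMap ℚ[X] (RatFunc ℚ) (qIntPoly r) = qInt r := by
  have h1 : (1 : ℚ[X]) - X ≠ 0 := by
    intro h
    have h2 := congrArg (Polynomial.eval 0) h
    simp at h2
  have h3 : (1 : RatFunc ℚ) - q ≠ 0 := by
    have h4 := (map_ne_zero_iff (algebraMap ℚ[X] (RatFunc ℚ))
      (RatFunc.algebraMap_injective ℚ)).2 h1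
    simpa [q, RatFunc.algebraMap_X] using h4
  rw [qInt, eq_div_iff h3]
  have h5 : qIntPoly r * (1 - X) = 1 - X ^ r := geom_sum_mul_neg X r
  have h6 := congrArg (algebraMap ℚ[X] (RatFunc ℚ)) h5
  simpa [q, RatFunc.algebraMap_X] using h6

/-- Congruence of rational functions modulo a polynomial `P`: the numerator of `A - B`, written in
lowest terms, is divisible by `P`. -/
def RatCongr (P : ℚ[X]) (A B : RatFunc ℚ) : Prop := P ∣ (A - B).num

end QSuper

/-!
Write `n = 3 m + 1` and `koebe z = z / (1 - z) ^ 2`. The sum of the `F k` is deformed by a parameter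
`U = 2 - u - u⁻¹`, which multiplies `F k` by
`D k = ∏ i < k, (1 + U koebe (q ^ (3 i + 1))) / (1 + U koebe (q ^ (3 i + 3)))`. At `u = q ^ n`,
Jackson's sum for the terminating very-well-poised `₈φ₇` evaluates both `∑ k ≤ m, F k * D k` and
`∑ k ≤ m, F k * D k ^ 2`, and

  `∑ F k = 2 ∑ F k * D k - ∑ F k * D k ^ 2 + ∑ F k * (D k - 1) ^ 2`.

Since `Φ_n ^ 2` divides `U`, the last sum `U ^ 2 ∑ F k * ((D k - 1) / U) ^ 2` carries `Φ_n ^ 4`; a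
fifth factor appears because, at a primitive `n`-th root of unity, `k ↦ m - k` changes the sign of
`F k` and preserves the value of `((D k - 1) / U) ^ 2`. The two evaluated sums contain the factor
`1 - q ^ n`, so it is enough to expand them to first order in `U`. The `F k` with `m < k < n` are
divisible by `Φ_n ^ 6`.

At a primitive `d`-th root of unity, for a divisor `1 < d < n` of `n`, the sum splits into blocks of
length `d`, each proportional to the first one, which vanishes by the same symmetry.
-/

namespace QSuper

open Polynomial

section Pochhammer

variable {R : Type*} [CommRing R]

@[simp]
theorem qPoch_zero (x p : R) : qPoch x p 0 = 1 := Finset.prod_range_zero _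

theorem qPoch_succ (x p : R) (k : ℕ) : qPoch x p (k + 1) = qPoch x p k * (1 - x * p ^ k) :=
  Finset.prod_range_succ _ _

theorem qPoch_add (x p : R) (k l : ℕ) :
    qPoch x p (k + l) = qPoch x p k * qPoch (x * p ^ k) p l := by
  simp only [qPoch, Finset.prod_range_add, pow_add, mul_assoc]

theorem one_sub_mul_qPoch_mul (x p : R) (k : ℕ) :
    (1 - x) * qPoch (x * p) p k = qPoch x p k * (1 - x * p ^ k) := by
  rw [← qPoch_succ, add_comm, qPoch_add, pow_one, qPoch_succ, qPoch_zero, pow_zero, mul_one,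
    one_mul]

theorem mul_prod_erase_eq_qPoch (x p : R) {i k : ℕ} (hi : i < k) :
    (1 - x * p ^ i) * ∏ j ∈ (Finset.range k).erase i, (1 - x * p ^ j) = qPoch x p k :=
  Finset.mul_prod_erase _ (fun j => 1 - x * p ^ j) (Finset.mem_range.2 hi)

theorem qPoch_eq_zero {x p : R} {i k : ℕ} (hi : i < k) (h : x * p ^ i = 1) : qPoch x p k = 0 :=
  Finset.prod_eq_zero (Finset.mem_range.2 hi) (by rw [h, sub_self])

theorem one_sub_mul_pow_ne_zero {x p : R} {k : ℕ} (h : qPoch x p (k + 1) ≠ 0) :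
    1 - x * p ^ k ≠ 0 :=
  right_ne_zero_of_mul (qPoch_succ x p k ▸ h)

theorem qPoch_ne_zero [IsDomain R] {x p : R} {k : ℕ} (h : ∀ i < k, x * p ^ i ≠ 1) :
    qPoch x p k ≠ 0 :=
  Finset.prod_ne_zero_iff.2 fun i hi => sub_ne_zero.2 (h i (Finset.mem_range.1 hi)).symm

end Pochhammer

section Jackson

variable {K : Type*} [Field K] {p a b c d e g : K}

/-- The well-poised quotient `(x; p)_k / (a p / x; p)_k`. -/
def wpRatio (p a x : K) (k : ℕ) : K := qPoch x p k / qPoch (a * p / x) p k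

/-- The `k`-th term of the very-well-poised series `₈φ₇` in base `p` with leading parameter `a` and
further parameters `b, c, d, e, f`. -/
def jacksonTerm (p a b c d e f : K) (k : ℕ) : K :=
  (1 - a * p ^ (2 * k)) / (1 - a) *
    (wpRatio p a a k * wpRatio p a b k * wpRatio p a c k * wpRatio p a d k * wpRatio p a e k *
      wpRatio p a f k) * p ^ k

theorem wpRatio_succ (p a x : K) (k : ℕ) :
    wpRatio p a x (k + 1) = wpRatio p a x k * ((1 - x * p ^ k) / (1 - a * p / x * p ^ k)) := by
  rw [wpRatio, wpRatio, qPoch_succ, qPoch_succ, mul_div_mul_comm]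

theorem wpRatio_succ_mul {x : K} {k : ℕ} (h : qPoch (a * p / x) p (k + 1) ≠ 0) :
    wpRatio p a x (k + 1) * (1 - a * p / x * p ^ k) = wpRatio p a x k * (1 - x * p ^ k) := by
  rw [wpRatio_succ, mul_assoc, div_mul_cancel₀ _ (one_sub_mul_pow_ne_zero h)]

theorem wpRatio_eq_mul (hp : p ≠ 0) {x : K} {k : ℕ} (h : qPoch (a / x) p (k + 1) ≠ 0) :
    wpRatio p a x k = wpRatio p (a / p) x k * ((1 - a / x) / (1 - a / x * p ^ k)) := by
  have hk := one_sub_mul_pow_ne_zero h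
  have hk' : qPoch (a / x) p k ≠ 0 := left_ne_zero_of_mul (qPoch_succ (a / x) p k ▸ h)
  have hs := one_sub_mul_qPoch_mul (a / x) p k
  have hs' := right_ne_zero_of_mul (a := 1 - a / x) (hs ▸ mul_ne_zero hk' hk)
  rw [wpRatio, wpRatio, div_mul_cancel₀ _ hp, mul_div_right_comm, div_mul_div_comm,
    div_eq_div_iff hs' (mul_ne_zero hk' hk)]
  linear_combination -qPoch x p k * hs

theorem wpRatio_mul_eq_mul (hp : p ≠ 0) {x : K} (hx : 1 - x ≠ 0) (k : ℕ) :
    wpRatio p a (x * p) k = wpRatio p (a / p) x k * ((1 - x * p ^ k) / (1 - x)) := by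
  rw [wpRatio, wpRatio, div_mul_cancel₀ _ hp, mul_div_mul_right _ _ hp, div_mul_div_comm,
    ← one_sub_mul_qPoch_mul, mul_comm (1 - x), mul_div_mul_right _ _ hx]

/- Both sides change sign under `e ↔ g`. Under `y ↦ 1 / (a y)` the two products on the right are
interchanged up to a common factor, so their difference is `y (1 - a y ^ 2)` times a combination of
`(1 - e y) (1 - a y / e)` and `(1 - g y) (1 - a y / g)`. -/
theorem jackson_certificate (ha : a ≠ 0) (h : b * c * d * e * g = a ^ 2) (y : K) :
    y * (1 - a * y ^ 2) *
        (g * (1 - g) * ((1 - a / (b * g)) * (1 - a / (c * g)) * (1 - a / (d * g))) *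
            ((1 - e * y) * (1 - a / e * y)) -
          e * (1 - e) * ((1 - a / (b * e)) * (1 - a / (c * e)) * (1 - a / (d * e))) *
            ((1 - g * y) * (1 - a / g * y))) =
      (g - e) *
        ((1 - a * y) * (1 - b * y) * (1 - c * y) * (1 - d * y) * (1 - e * y) * (1 - g * y) -
          (1 - y) * (1 - a / b * y) * (1 - a / c * y) * (1 - a / d * y) * (1 - a / e * y) *
            (1 - a / g * y)) := by
  have h0 : b * c * d * e * g ≠ 0 := h ▸ pow_ne_zero 2 ha
  simp only [mul_ne_zero_iff] at h0
  obtain ⟨⟨⟨⟨hb, hc⟩, hd⟩, he⟩, hg⟩ := h0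
  obtain rfl : b = a ^ 2 / (c * d * e * g) := by
    rw [eq_div_iff (by simp [*])]
    linear_combination h
  field_simp
  ring

/-- The coefficient of the series with parameters `e p, g` in the contiguous relation
`sum_jacksonTerm_contiguous`; that of the series with parameters `e, g p` has `g` replaced by
`e`. -/
def contiguousCoeff (a b c d x : K) : K :=
  x * ((1 - a / (b * x)) * (1 - a / (c * x)) * (1 - a / (d * x))) / (1 - a / x)

/-- The sequence whose differences are the terms of the contiguous relation
`sum_jacksonTerm_contiguous`. -/
def jacksonPrimitive (p a b c d e g : K) (k : ℕ) : K :=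
  (g - e) / ((1 - a) * (1 - e) * (1 - g)) *
    (wpRatio p a a k * wpRatio p a b k * wpRatio p a c k * wpRatio p a d k *
      wpRatio p (a / p) e k * wpRatio p (a / p) g k) *
    ((1 - p ^ k) * (1 - a / b * p ^ k) * (1 - a / c * p ^ k) * (1 - a / d * p ^ k))

theorem jacksonPrimitive_succ (hp : p ≠ 0) (ha : a ≠ 0) {k : ℕ} (h1 : qPoch p p (k + 1) ≠ 0)
    (hb : qPoch (a * p / b) p (k + 1) ≠ 0) (hc : qPoch (a * p / c) p (k + 1) ≠ 0)
    (hd : qPoch (a * p / d) p (k + 1) ≠ 0) :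
    jacksonPrimitive p a b c d e g (k + 1) =
      (g - e) / ((1 - a) * (1 - e) * (1 - g)) *
        (wpRatio p a a k * wpRatio p a b k * wpRatio p a c k * wpRatio p a d k *
          wpRatio p (a / p) e k * wpRatio p (a / p) g k) *
        ((1 - a * p ^ k) * (1 - b * p ^ k) * (1 - c * p ^ k) * (1 - d * p ^ k) *
          (1 - e * p ^ k) * (1 - g * p ^ k) / ((1 - a / e * p ^ k) * (1 - a / g * p ^ k))) := by
  have shift (x : K) : 1 - a / x * p ^ (k + 1) = 1 - a * p / x * p ^ k := by ring
  have ha' : wpRatio p a a (k + 1) * (1 - p ^ (k + 1)) = wpRatio p a a k * (1 - a * p ^ k) := by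
    rw [← wpRatio_succ_mul (by rwa [mul_div_cancel_left₀ p ha]), ← shift, div_self ha, one_mul]
  have hb' := wpRatio_succ_mul hb
  have hc' := wpRatio_succ_mul hc
  have hd' := wpRatio_succ_mul hd
  rw [jacksonPrimitive, shift, shift, shift, wpRatio_succ _ _ e, wpRatio_succ _ _ g,
    div_mul_cancel₀ _ hp]
  calc
    _ = (g - e) / ((1 - a) * (1 - e) * (1 - g)) *
          (wpRatio p a a (k + 1) * (1 - p ^ (k + 1)) *
            (wpRatio p a b (k + 1) * (1 - a * p / b * p ^ k)) *
            (wpRatio p a c (k + 1) * (1 - a * p / c * p ^ k)) *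
            (wpRatio p a d (k + 1) * (1 - a * p / d * p ^ k)) *
            (wpRatio p (a / p) e k * ((1 - e * p ^ k) / (1 - a / e * p ^ k))) *
            (wpRatio p (a / p) g k * ((1 - g * p ^ k) / (1 - a / g * p ^ k)))) := by ac_rfl
    _ = _ := by
      rw [ha', hb', hc', hd']
      generalize 1 - a / e * p ^ k = u, 1 - a / g * p ^ k = v
      ring

theorem jacksonTerm_contiguous (hp : p ≠ 0) (ha : a ≠ 0) (h : b * c * d * e * g = a ^ 2)
    (ha1 : 1 - a ≠ 0) (he : 1 - e ≠ 0) (hg : 1 - g ≠ 0) {k : ℕ} (h1 : qPoch p p (k + 1) ≠ 0)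
    (hb : qPoch (a * p / b) p (k + 1) ≠ 0) (hc : qPoch (a * p / c) p (k + 1) ≠ 0)
    (hd : qPoch (a * p / d) p (k + 1) ≠ 0) (hae : ∀ i ≤ k, 1 - a / e * p ^ i ≠ 0)
    (hag : ∀ i ≤ k, 1 - a / g * p ^ i ≠ 0) :
    contiguousCoeff a b c d g * jacksonTerm p a b c d (e * p) g k -
        contiguousCoeff a b c d e * jacksonTerm p a b c d e (g * p) k =
      jacksonPrimitive p a b c d e g (k + 1) - jacksonPrimitive p a b c d e g k := by
  have hae' : qPoch (a / e) p (k + 1) ≠ 0 := Finset.prod_ne_zero_iff.2 fun i hi =>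
    hae i (Nat.lt_succ_iff.1 (Finset.mem_range.1 hi))
  have hag' : qPoch (a / g) p (k + 1) ≠ 0 := Finset.prod_ne_zero_iff.2 fun i hi =>
    hag i (Nat.lt_succ_iff.1 (Finset.mem_range.1 hi))
  have hek : 1 - a / e * p ^ k ≠ 0 := hae k le_rfl
  have hgk : 1 - a / g * p ^ k ≠ 0 := hag k le_rfl
  have he0 : 1 - a / e ≠ 0 := by simpa using hae 0 (Nat.zero_le k)
  have hg0 : 1 - a / g ≠ 0 := by simpa using hag 0 (Nat.zero_le k)
  rw [jacksonPrimitive_succ hp ha h1 hb hc hd, jacksonPrimitive, jacksonTerm, jacksonTerm,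
    wpRatio_mul_eq_mul hp he, wpRatio_mul_eq_mul hp hg, wpRatio_eq_mul hp hae',
    wpRatio_eq_mul hp hag', contiguousCoeff, contiguousCoeff, mul_comm 2 k, pow_mul]
  generalize wpRatio p a a k * wpRatio p a b k * wpRatio p a c k * wpRatio p a d k = W
  generalize wpRatio p (a / p) e k = E
  generalize wpRatio p (a / p) g k = G
  have key := jackson_certificate ha h (p ^ k)
  generalize p ^ k = y at *
  generalize 1 - a / e * y = u, 1 - a / g * y = v, 1 - a / e = u₀, 1 - a / g = v₀, 1 - e = e',
    1 - g = g', 1 - a = a' at *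
  generalize (1 - a / (b * g)) * (1 - a / (c * g)) * (1 - a / (d * g)) = P,
    (1 - a / (b * e)) * (1 - a / (c * e)) * (1 - a / (d * e)) = Q at *
  generalize 1 - a / b * y = b', 1 - a / c * y = c', 1 - a / d * y = d' at *
  field_simp
  linear_combination W * E * G * key

theorem sum_jacksonTerm_contiguous (hp : p ≠ 0) (ha : a ≠ 0) (h : b * c * d * e * g = a ^ 2)
    {N : ℕ} (ha1 : 1 - a ≠ 0) (he : 1 - e ≠ 0) (hg : 1 - g ≠ 0)
    (h1 : ∀ k, p * p ^ k ≠ 1) (hb : ∀ k, a * p / b * p ^ k ≠ 1) (hc : ∀ k, a * p / c * p ^ k ≠ 1)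
    (hd : ∀ k, a * p / d * p ^ k ≠ 1) (hae : ∀ k < N, a / e * p ^ k ≠ 1)
    (hag : ∀ k < N, a / g * p ^ k ≠ 1) (hN : qPoch g p N = 0) :
    contiguousCoeff a b c d g * ∑ k ∈ Finset.range N, jacksonTerm p a b c d (e * p) g k =
      contiguousCoeff a b c d e * ∑ k ∈ Finset.range N, jacksonTerm p a b c d e (g * p) k := by
  rw [← sub_eq_zero, Finset.mul_sum, Finset.mul_sum, ← Finset.sum_sub_distrib]
  calc
    _ = ∑ k ∈ Finset.range N,
          (jacksonPrimitive p a b c d e g (k + 1) - jacksonPrimitive p a b c d e g k) := by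
      refine Finset.sum_congr rfl fun k hk => ?_
      have lt {i : ℕ} (hi : i ≤ k) : i < N := hi.trans_lt (Finset.mem_range.1 hk)
      exact jacksonTerm_contiguous hp ha h ha1 he hg (qPoch_ne_zero fun i _ => h1 i)
        (qPoch_ne_zero fun i _ => hb i) (qPoch_ne_zero fun i _ => hc i)
        (qPoch_ne_zero fun i _ => hd i) (fun i hi => sub_ne_zero.2 (hae i (lt hi)).symm)
        fun i hi => sub_ne_zero.2 (hag i (lt hi)).symm
    _ = 0 := by
      rw [Finset.sum_range_sub, jacksonPrimitive, jacksonPrimitive, wpRatio, wpRatio, wpRatio,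
        wpRatio, wpRatio, wpRatio, hN]
      simp

theorem contiguousCoeff_inv (a b c d P : K) :
    contiguousCoeff a b c d P⁻¹ =
      P⁻¹ * ((1 - a * P / b) * (1 - a * P / c) * (1 - a * P / d)) / (1 - a * P) := by
  simp only [contiguousCoeff, ← div_div, div_inv_eq_mul, div_mul_eq_mul_div]

theorem contiguousCoeff_div {P : K} (ha : a ≠ 0) (hb : b ≠ 0) (hc : c ≠ 0) (hd : d ≠ 0)
    (hP : P ≠ 0) (h : 1 - a * P / (b * c * d) ≠ 0) :
    contiguousCoeff a b c d (a ^ 2 * P / (b * c * d)) =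
      P⁻¹ * ((1 - a * P / (b * c)) * (1 - a * P / (b * d)) * (1 - a * P / (c * d))) /
        (1 - a * P / (b * c * d)) := by
  have flip : 1 - a / (a ^ 2 * P / (b * c * d)) =
      -(b * c * d / (a * P)) * (1 - a * P / (b * c * d)) := by
    field_simp
    ring
  rw [contiguousCoeff, flip]
  generalize 1 - a * P / (b * c * d) = w at h ⊢
  field_simp
  ring

theorem sum_jacksonTerm_succ (hp : p ≠ 0) (ha : a ≠ 0) (hb : b ≠ 0) (hc : c ≠ 0) (hd : d ≠ 0)
    (h1 : ∀ k, p * p ^ k ≠ 1) (ha1 : ∀ k, a * p ^ k ≠ 1) (hab : ∀ k, a * p / b * p ^ k ≠ 1)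
    (hac : ∀ k, a * p / c * p ^ k ≠ 1) (had : ∀ k, a * p / d * p ^ k ≠ 1)
    (hl : ∀ k, a / (b * c * d) * p ^ k ≠ 1) (he : ∀ k, a ^ 2 * p / (b * c * d) * p ^ k ≠ 1)
    (n : ℕ) :
    contiguousCoeff a b c d (p ^ (n + 1))⁻¹ * ∑ k ∈ Finset.range (n + 2),
        jacksonTerm p a b c d (a ^ 2 * p ^ (n + 2) / (b * c * d)) (p ^ (n + 1))⁻¹ k =
      contiguousCoeff a b c d (a ^ 2 * p ^ (n + 1) / (b * c * d)) * ∑ k ∈ Finset.range (n + 1),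
        jacksonTerm p a b c d (a ^ 2 * p ^ (n + 1) / (b * c * d)) (p ^ n)⁻¹ k := by
  have hpn (k : ℕ) : p ^ k ≠ 0 := pow_ne_zero k hp
  have hgp : (p ^ (n + 1))⁻¹ * p = (p ^ n)⁻¹ := by
    rw [pow_succ, mul_inv, inv_mul_cancel_right₀ hp]
  have hep : a ^ 2 * p ^ (n + 1) / (b * c * d) * p = a ^ 2 * p ^ (n + 2) / (b * c * d) := by ring
  have hlast (x : K) : jacksonTerm p a b c d x (p ^ n)⁻¹ (n + 1) = 0 := by
    rw [jacksonTerm, wpRatio, wpRatio, wpRatio, wpRatio, wpRatio, wpRatio,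
      qPoch_eq_zero (x := (p ^ n)⁻¹) (Nat.lt_succ_self n) (inv_mul_cancel₀ (hpn n))]
    simp
  have h := sum_jacksonTerm_contiguous (b := b) (c := c) (d := d)
    (e := a ^ 2 * p ^ (n + 1) / (b * c * d)) (g := (p ^ (n + 1))⁻¹) (N := n + 2) hp ha
    (by field_simp) (sub_ne_zero.2 (by simpa using (ha1 0).symm))
    (sub_ne_zero.2 fun h => he n (by rw [h]; ring))
    (sub_ne_zero.2 fun h => h1 n (by rw [← pow_succ', ← inv_inv (p ^ _), ← h, inv_one]))
    h1 hab hac had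
    (fun k hk h => hl (n + 1 - k) (by
      rw [← inv_inj, inv_one, ← h, mul_inv, inv_div, pow_sub₀ p hp (Nat.lt_succ_iff.1 hk)]
      have := hpn k
      field_simp))
    (fun k _ h => ha1 (n + 1 + k) (by rw [← h, div_inv_eq_mul, pow_add, mul_assoc]))
    (qPoch_eq_zero (Nat.lt_succ_self _) (inv_mul_cancel₀ (hpn _)))
  rwa [hgp, hep, Finset.sum_range_succ _ (n + 1), Finset.sum_range_succ _ (n + 1), hlast,
    add_zero, ← Finset.sum_range_succ] at h

/-- Jackson's sum; the parameter `a ^ 2 * p ^ (n + 1) / (b * c * d)` is the one forced by the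
balancing condition. -/
theorem sum_jacksonTerm (hp : p ≠ 0) (ha : a ≠ 0) (hb : b ≠ 0) (hc : c ≠ 0) (hd : d ≠ 0)
    (h1 : ∀ k, p * p ^ k ≠ 1) (ha1 : ∀ k, a * p ^ k ≠ 1) (hab : ∀ k, a * p / b * p ^ k ≠ 1)
    (hac : ∀ k, a * p / c * p ^ k ≠ 1) (had : ∀ k, a * p / d * p ^ k ≠ 1)
    (hl : ∀ k, a / (b * c * d) * p ^ k ≠ 1) (he : ∀ k, a ^ 2 * p / (b * c * d) * p ^ k ≠ 1)
    (n : ℕ) :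
    ∑ k ∈ Finset.range (n + 1),
        jacksonTerm p a b c d (a ^ 2 * p ^ (n + 1) / (b * c * d)) (p ^ n)⁻¹ k =
      qPoch (a * p) p n * (qPoch (a * p / (b * c)) p n * qPoch (a * p / (b * d)) p n *
          qPoch (a * p / (c * d)) p n) /
        (qPoch (a * p / b) p n * qPoch (a * p / c) p n * qPoch (a * p / d) p n *
          qPoch (a * p / (b * c * d)) p n) := by
  induction n with
  | zero =>
    have : 1 - a ≠ 0 := sub_ne_zero.2 (by simpa using (ha1 0).symm)
    simp [jacksonTerm, wpRatio, this]
  | succ n ih =>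
    have ne {x : K} (h : ∀ k, x * p ^ k ≠ 1) (k : ℕ) : 1 - x * p ^ k ≠ 0 := sub_ne_zero.2 (h k).symm
    have shift (x : K) : a * p / x * p ^ n = a * p ^ (n + 1) / x := by ring
    have hl' := ne hl (n + 1)
    rw [div_mul_eq_mul_div] at hl'
    have h := sum_jacksonTerm_succ hp ha hb hc hd h1 ha1 hab hac had hl he n
    rw [ih, contiguousCoeff_inv,
      contiguousCoeff_div ha hb hc hd (pow_ne_zero _ hp) hl'] at h
    have hs (x : K) : qPoch x p (n + 1) = qPoch x p n * (1 - x * p ^ n) := qPoch_succ x p n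
    simp only [hs, shift, mul_assoc a p, ← pow_succ']
    have ha' := ne ha1 (n + 1)
    have hab' := ne hab n
    have hac' := ne hac n
    have had' := ne had n
    rw [shift] at hab' hac' had'
    have hP := pow_ne_zero (n + 1) hp
    generalize p ^ (n + 1) = P at *
    generalize 1 - a * P / b = u₁, 1 - a * P / c = u₂, 1 - a * P / d = u₃,
      1 - a * P / (b * c * d) = u₄, 1 - a * P = u at *
    rw [mul_comm, ← eq_div_iff (by simp [*])] at h
    have ratio (T v : K) :
        P⁻¹ * v / u₄ * T / (P⁻¹ * (u₁ * u₂ * u₃) / u) = T * (u * v / (u₁ * u₂ * u₃ * u₄)) := by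
      field_simp
    rw [h, ratio, div_mul_div_comm]
    congr 1 <;> ring

end Jackson

section Deformation

variable {K : Type*} [Field K]

/-- The Koebe function `z / (1 - z) ^ 2`, invariant under `z ↦ 1 / z`. -/
def koebe (z : K) : K := z / (1 - z) ^ 2

/-- The parameter through which a balanced pair of factors `(1 - z u) (1 - z / u)` depends on
`u`. -/
def pairParam (u : K) : K := 2 - u - u⁻¹

/-- The factor by which the square of `(x; p)_k / (y; p)_k` changes when it is replaced by
`(x u; p)_k (x / u; p)_k / ((y u; p)_k (y / u; p)_k)`, where `U = pairParam u`. -/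
def deform (p x y U : K) (k : ℕ) : K :=
  ∏ i ∈ Finset.range k, (1 + U * koebe (x * p ^ i)) / (1 + U * koebe (y * p ^ i))

/-- The quotient `(t ^ a; t ^ 3)_k / (t ^ 3; t ^ 3)_k`. -/
def pochRatio (t : K) (a k : ℕ) : K := qPoch (t ^ a) (t ^ 3) k / qPoch (t ^ 3) (t ^ 3) k

/-- The `k`-th summand of the truncated series, at an arbitrary point `t` of a field. -/
def summand (t : K) (k : ℕ) : K :=
  (1 - t ^ (6 * k + 1)) / (1 - t) * pochRatio t 1 k ^ 6 * t ^ (3 * k)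

@[simp]
theorem pairParam_one : pairParam (1 : K) = 0 := by norm_num [pairParam]

@[simp]
theorem deform_zero_right (p x y : K) (k : ℕ) : deform p x y 0 k = 1 := by simp [deform]

theorem qPoch_mul_mul_qPoch_div {p x u : K} (hu : u ≠ 0) (hx : ∀ i, x * p ^ i ≠ 1) (k : ℕ) :
    qPoch (x * u) p k * qPoch (x / u) p k =
      qPoch x p k ^ 2 * ∏ i ∈ Finset.range k, (1 + pairParam u * koebe (x * p ^ i)) := by
  simp only [qPoch, ← Finset.prod_mul_distrib, ← Finset.prod_pow]
  refine Finset.prod_congr rfl fun i _ => ?_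
  have h : 1 - x * p ^ i ≠ 0 := sub_ne_zero.2 (hx i).symm
  rw [koebe, pairParam, mul_right_comm, div_mul_eq_mul_div]
  generalize x * p ^ i = z at *
  field_simp
  ring

theorem qPoch_pair_div_qPoch_pair {p x y u : K} (hu : u ≠ 0) (hx : ∀ i, x * p ^ i ≠ 1)
    (hy : ∀ i, y * p ^ i ≠ 1) (k : ℕ) :
    qPoch (x * u) p k * qPoch (x / u) p k / (qPoch (y * u) p k * qPoch (y / u) p k) =
      (qPoch x p k / qPoch y p k) ^ 2 * deform p x y (pairParam u) k := by
  rw [qPoch_mul_mul_qPoch_div hu hx, qPoch_mul_mul_qPoch_div hu hy, mul_div_mul_comm, div_pow,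
    deform, Finset.prod_div_distrib]

variable {t u : K}

theorem pow_mul_pow_three_ne_one (ht : Function.Injective fun k : ℕ => t ^ k) {a : ℕ} (ha : 0 < a)
    (i : ℕ) : t ^ a * (t ^ 3) ^ i ≠ 1 := by
  rw [← pow_mul, ← pow_add, ← pow_zero t]
  exact ht.ne (by omega)

theorem ne_zero_of_pow_injective (ht : Function.Injective fun k : ℕ => t ^ k) : t ≠ 0 := by
  rintro rfl
  exact absurd (@ht 1 2 (by simp)) (by norm_num)

theorem wpRatio_mul_wpRatio_div (ht : Function.Injective fun k : ℕ => t ^ k) (hu : u ≠ 0) (k : ℕ) :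
    wpRatio (t ^ 3) t (t * u) k * wpRatio (t ^ 3) t (t / u) k =
      pochRatio t 1 k ^ 2 * deform (t ^ 3) t (t ^ 3) (pairParam u) k := by
  have ht0 := ne_zero_of_pow_injective ht
  have h1 : ∀ i, t * (t ^ 3) ^ i ≠ 1 := by simpa using pow_mul_pow_three_ne_one ht one_pos
  rw [pochRatio, pow_one, ← qPoch_pair_div_qPoch_pair hu h1 (pow_mul_pow_three_ne_one ht three_pos),
    wpRatio, wpRatio, div_mul_div_comm, mul_div_mul_left _ _ ht0,
    show t * t ^ 3 / (t / u) = t ^ 3 * u by field_simp, mul_comm (qPoch (t ^ 3 / u) _ _)]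

theorem jacksonTerm_eq_summand_mul (ht : Function.Injective fun k : ℕ => t ^ k) {v : K}
    (hu : u ≠ 0) (hv : v ≠ 0) (k : ℕ) :
    jacksonTerm (t ^ 3) t t (t * u) (t / u) (t * v) (t / v) k =
      summand t k * deform (t ^ 3) t (t ^ 3) (pairParam u) k *
        deform (t ^ 3) t (t ^ 3) (pairParam v) k := by
  have ht0 := ne_zero_of_pow_injective ht
  have hw : wpRatio (t ^ 3) t t k = pochRatio t 1 k := by
    rw [wpRatio, pochRatio, pow_one, mul_div_cancel_left₀ _ ht0]
  calc
    _ = (1 - t * (t ^ 3) ^ (2 * k)) / (1 - t) * (wpRatio (t ^ 3) t t k ^ 2 *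
          (wpRatio (t ^ 3) t (t * u) k * wpRatio (t ^ 3) t (t / u) k) *
          (wpRatio (t ^ 3) t (t * v) k * wpRatio (t ^ 3) t (t / v) k)) * (t ^ 3) ^ k := by
      rw [jacksonTerm]
      ring
    _ = _ := by
      rw [wpRatio_mul_wpRatio_div ht hu, wpRatio_mul_wpRatio_div ht hv, hw, summand]
      ring

theorem sum_jacksonTerm_pair (ht : Function.Injective fun k : ℕ => t ^ k) (hu : u ≠ 0)
    (hu1 : ∀ k, t ^ 3 * u * (t ^ 3) ^ k ≠ 1) (hu2 : ∀ k, t ^ 3 / u * (t ^ 3) ^ k ≠ 1) (m : ℕ) :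
    ∑ k ∈ Finset.range (m + 1),
        jacksonTerm (t ^ 3) t t (t * u) (t / u) (t * t ^ (3 * m + 1)) (t / t ^ (3 * m + 1)) k =
      qPoch (t * t ^ 3) (t ^ 3) m * (qPoch (t ^ 2 / u) (t ^ 3) m * qPoch (t ^ 2 * u) (t ^ 3) m *
          qPoch (t ^ 2) (t ^ 3) m) /
        (qPoch (t ^ 3) (t ^ 3) m * qPoch (t ^ 3 / u) (t ^ 3) m * qPoch (t ^ 3 * u) (t ^ 3) m *
          qPoch t (t ^ 3) m) := by
  have ht0 := ne_zero_of_pow_injective ht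
  have ht3 : t ^ 3 ≠ 0 := pow_ne_zero 3 ht0
  have hne {a : ℕ} (ha : 0 < a) := pow_mul_pow_three_ne_one ht ha
  have hbcd : t * (t * u) * (t / u) = t ^ 3 := by field_simp
  have hE : t ^ 2 * (t ^ 3) ^ (m + 1) / t ^ 3 = t * t ^ (3 * m + 1) := by
    field_simp
    ring
  have hF : ((t ^ 3) ^ m)⁻¹ = t / t ^ (3 * m + 1) := by
    rw [pow_succ t (3 * m), pow_mul]
    field_simp
  have hab : t * t ^ 3 / t = t ^ 3 := mul_div_cancel_left₀ _ ht0
  have hac : t * t ^ 3 / (t * u) = t ^ 3 / u := mul_div_mul_left _ _ ht0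
  have had : t * t ^ 3 / (t / u) = t ^ 3 * u := by field_simp
  have habc : t * t ^ 3 / (t * (t * u)) = t ^ 2 / u := by field_simp
  have habd : t * t ^ 3 / (t * (t / u)) = t ^ 2 * u := by field_simp
  have hacd : t * t ^ 3 / (t * u * (t / u)) = t ^ 2 := by field_simp
  have hl (k : ℕ) : t / t ^ 3 * (t ^ 3) ^ k ≠ 1 := fun h => by
    have h' : t ^ (3 * k + 1) = t ^ 3 := by
      rw [div_mul_eq_mul_div, div_eq_one_iff_eq ht3] at h
      rw [← h, pow_succ', pow_mul]
    exact absurd (ht h') (by omega)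
  have h := sum_jacksonTerm (p := t ^ 3) (a := t) (b := t) (c := t * u) (d := t / u) ht3 ht0 ht0
    (mul_ne_zero ht0 hu) (div_ne_zero ht0 hu) (hne three_pos) (by simpa using hne one_pos)
    (by rw [hab]; exact hne three_pos) (by rwa [hac]) (by rwa [had]) (by rwa [hbcd])
    (by rw [hbcd, mul_div_cancel_right₀ _ ht3]; exact hne two_pos) m
  rwa [hbcd, hE, hF, hab, hac, had, habc, habd, hacd, mul_div_cancel_right₀ _ ht3] at h

theorem sum_summand_mul_deform (ht : Function.Injective fun k : ℕ => t ^ k) (hu : u ≠ 0)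
    (hu1 : ∀ k, t ^ 3 * u * (t ^ 3) ^ k ≠ 1) (hu2 : ∀ k, t ^ 3 / u * (t ^ 3) ^ k ≠ 1) (m : ℕ) :
    ∑ k ∈ Finset.range (m + 1), summand t k * deform (t ^ 3) t (t ^ 3) (pairParam u) k *
        deform (t ^ 3) t (t ^ 3) (pairParam (t ^ (3 * m + 1))) k =
      (1 - t ^ (3 * m + 1)) / (1 - t) * pochRatio t 2 m ^ 3 *
        deform (t ^ 3) (t ^ 2) (t ^ 3) (pairParam u) m := by
  have hne {a : ℕ} (ha : 0 < a) := pow_mul_pow_three_ne_one ht ha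
  have h1 : ∀ i, t * (t ^ 3) ^ i ≠ 1 := by simpa using hne one_pos
  have ht1 : 1 - t ≠ 0 := sub_ne_zero.2 (by simpa using (h1 0).symm)
  have hpair := qPoch_pair_div_qPoch_pair hu (hne two_pos) (hne three_pos) m
  have hlead : qPoch (t * t ^ 3) (t ^ 3) m / qPoch t (t ^ 3) m =
      (1 - t ^ (3 * m + 1)) / (1 - t) := by
    rw [div_eq_div_iff (qPoch_ne_zero fun i _ => h1 i) ht1, mul_comm, one_sub_mul_qPoch_mul,
      mul_comm, pow_succ' t (3 * m), pow_mul]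
  calc
    _ = qPoch (t * t ^ 3) (t ^ 3) m / qPoch t (t ^ 3) m * pochRatio t 2 m *
          (qPoch (t ^ 2 * u) (t ^ 3) m * qPoch (t ^ 2 / u) (t ^ 3) m /
            (qPoch (t ^ 3 * u) (t ^ 3) m * qPoch (t ^ 3 / u) (t ^ 3) m)) := by
      simp only [← jacksonTerm_eq_summand_mul ht hu (pow_ne_zero _ (ne_zero_of_pow_injective ht))]
      rw [sum_jacksonTerm_pair ht hu hu1 hu2, pochRatio, div_mul_div_comm, div_mul_div_comm]
      congr 1 <;> ring
    _ = (1 - t ^ (3 * m + 1)) / (1 - t) * pochRatio t 2 m *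
          (pochRatio t 2 m ^ 2 * deform (t ^ 3) (t ^ 2) (t ^ 3) (pairParam u) m) := by
      rw [hpair, hlead, ← pochRatio]
    _ = _ := by ring

theorem sum_summand (ht : Function.Injective fun k : ℕ => t ^ k) (m : ℕ) :
    ∑ k ∈ Finset.range (m + 1), summand t k =
      (1 - t ^ (3 * m + 1)) / (1 - t) * pochRatio t 2 m ^ 3 *
          (2 - deform (t ^ 3) (t ^ 2) (t ^ 3) (pairParam (t ^ (3 * m + 1))) m) +
        ∑ k ∈ Finset.range (m + 1), summand t k *
          (deform (t ^ 3) t (t ^ 3) (pairParam (t ^ (3 * m + 1))) k - 1) ^ 2 := by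
  have ht0 := ne_zero_of_pow_injective ht
  have once := sum_summand_mul_deform ht one_ne_zero
    (by simpa using pow_mul_pow_three_ne_one ht three_pos)
    (by simpa using pow_mul_pow_three_ne_one ht three_pos) m
  have twice := sum_summand_mul_deform ht (u := t ^ (3 * m + 1)) (pow_ne_zero _ ht0)
    (fun k => by simpa only [← pow_add] using pow_mul_pow_three_ne_one ht (by omega) k)
    (fun k h => by
      rw [div_mul_eq_mul_div, div_eq_one_iff_eq (pow_ne_zero _ ht0), ← pow_mul, ← pow_add] at h
      exact absurd (ht h) (by omega)) m
  simp only [pairParam_one, deform_zero_right, mul_one] at once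
  rw [mul_sub, ← twice, mul_comm _ (2 : K), ← once, Finset.mul_sum, ← Finset.sum_sub_distrib,
    ← Finset.sum_add_distrib]
  exact Finset.sum_congr rfl fun k _ => by ring

end Deformation

section Reflection

variable {F : Type*} [Field F] {ζ : F} {k l r : ℕ}

/-- The sum `∑ i < k, (koebe (x p ^ i) - koebe (y p ^ i))`, the linear coefficient of
`deform p x y U k` in `U`. -/
def koebeSum (p x y : F) (k : ℕ) : F :=
  ∑ i ∈ Finset.range k, (koebe (x * p ^ i) - koebe (y * p ^ i))

theorem koebe_eq_of_mul_eq_one {z w : F} (h : z * w = 1) : koebe z = koebe w := by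
  obtain rfl := eq_inv_of_mul_eq_one_right h
  have hz : z ≠ 0 := left_ne_zero_of_mul_eq_one h
  rcases eq_or_ne z 1 with rfl | hz1
  · rw [inv_one]
  · have h1 : 1 - z ≠ 0 := sub_ne_zero.2 hz1.symm
    have h2 : z - 1 ≠ 0 := sub_ne_zero.2 hz1
    rw [koebe, koebe]
    field_simp
    ring

theorem one_sub_sq_of_mul_eq_one {z w : F} (h : z * w = 1) : (1 - z) ^ 2 = z ^ 2 * (1 - w) ^ 2 := by
  linear_combination (2 * z - z * w - 1) * h

theorem mul_pow_three_mul (hr : ζ ^ (3 * r + 1) = 1) (hkl : k + l + 1 = r) :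
    ζ * (ζ ^ 3) ^ k * (ζ ^ 3 * (ζ ^ 3) ^ l) = 1 := by
  rw [← hr, ← hkl]
  ring

theorem sum_koebe_add_sum_koebe (hr : ζ ^ (3 * r + 1) = 1) (hkl : k + l = r) :
    ∑ i ∈ Finset.range k, koebe (ζ * (ζ ^ 3) ^ i) +
        ∑ i ∈ Finset.range l, koebe (ζ ^ 3 * (ζ ^ 3) ^ i) =
      ∑ i ∈ Finset.range r, koebe (ζ ^ 3 * (ζ ^ 3) ^ i) := by
  induction k generalizing l with
  | zero =>
    obtain rfl : l = r := by omega
    rw [Finset.sum_range_zero, zero_add]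
  | succ k ih =>
    rw [← ih (l := l + 1) (by omega), Finset.sum_range_succ, Finset.sum_range_succ _ l,
      koebe_eq_of_mul_eq_one (mul_pow_three_mul hr (by omega : k + l + 1 = r))]
    ring

theorem koebeSum_reflect (hr : ζ ^ (3 * r + 1) = 1) (hkl : k + l = r) :
    koebeSum (ζ ^ 3) ζ (ζ ^ 3) k = koebeSum (ζ ^ 3) ζ (ζ ^ 3) l := by
  rw [koebeSum, koebeSum, Finset.sum_sub_distrib, Finset.sum_sub_distrib]
  linear_combination sum_koebe_add_sum_koebe hr hkl -
    sum_koebe_add_sum_koebe hr ((add_comm l k).trans hkl)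

theorem qPoch_sq_mul_qPoch_sq (hr : ζ ^ (3 * r + 1) = 1) (hkl : k + l = r) :
    ζ ^ k * (qPoch ζ (ζ ^ 3) k ^ 2 * qPoch (ζ ^ 3) (ζ ^ 3) l ^ 2) =
      ζ ^ (3 * k ^ 2) * qPoch (ζ ^ 3) (ζ ^ 3) r ^ 2 := by
  induction k generalizing l with
  | zero =>
    obtain rfl : l = r := by omega
    simp
  | succ k ih =>
    have h := ih (l := l + 1) (by omega)
    rw [qPoch_succ] at h
    rw [qPoch_succ, mul_pow _ (1 - _),
      one_sub_sq_of_mul_eq_one (mul_pow_three_mul hr (by omega : k + l + 1 = r)),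
      show 3 * (k + 1) ^ 2 = 3 * k ^ 2 + (6 * k + 3) by ring, pow_add ζ (3 * k ^ 2)]
    linear_combination ζ ^ (6 * k + 3) * h

theorem pow_mul_pochRatio_sq_reflect (hr : ζ ^ (3 * r + 1) = 1)
    (h0 : qPoch (ζ ^ 3) (ζ ^ 3) r ≠ 0) (hkl : k + l = r) :
    ζ ^ (2 * k) * pochRatio ζ 1 k ^ 2 = ζ ^ (2 * l) * pochRatio ζ 1 l ^ 2 := by
  have hk : qPoch (ζ ^ 3) (ζ ^ 3) k ≠ 0 :=
    left_ne_zero_of_mul (qPoch_add (ζ ^ 3) (ζ ^ 3) k l ▸ hkl ▸ h0)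
  have hl : qPoch (ζ ^ 3) (ζ ^ 3) l ≠ 0 :=
    left_ne_zero_of_mul (qPoch_add (ζ ^ 3) (ζ ^ 3) l k ▸ add_comm k l ▸ hkl ▸ h0)
  have h1 := qPoch_sq_mul_qPoch_sq hr hkl
  have h2 := qPoch_sq_mul_qPoch_sq hr ((add_comm l k).trans hkl)
  have hexp : ζ ^ (3 * k ^ 2) * ζ ^ k = ζ ^ (3 * l ^ 2) * ζ ^ l := by
    have hk' : ζ ^ ((3 * r + 1) * l) = 1 := by rw [pow_mul, hr, one_pow]
    have hl' : ζ ^ ((3 * r + 1) * k) = 1 := by rw [pow_mul, hr, one_pow]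
    rw [← mul_one (_ * ζ ^ k), ← hk', ← mul_one (_ * ζ ^ l), ← hl', ← hkl]
    ring
  rw [pochRatio, pochRatio, pow_one, div_pow, div_pow, mul_div_assoc', mul_div_assoc',
    div_eq_div_iff (pow_ne_zero 2 hk) (pow_ne_zero 2 hl)]
  linear_combination ζ ^ k * h1 - ζ ^ l * h2 + qPoch (ζ ^ 3) (ζ ^ 3) r ^ 2 * hexp

theorem summand_reflect (hr : ζ ^ (3 * r + 1) = 1) (h0 : qPoch (ζ ^ 3) (ζ ^ 3) r ≠ 0)
    (hkl : k + l = r) : summand ζ k = -summand ζ l := by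
  have hζ : ζ ≠ 0 := fun h => by simp [h] at hr
  have hR : (ζ ^ (2 * k) * pochRatio ζ 1 k ^ 2) ^ 3 = (ζ ^ (2 * l) * pochRatio ζ 1 l ^ 2) ^ 3 := by
    rw [pow_mul_pochRatio_sq_reflect hr h0 hkl]
  have hlead : ζ ^ (3 * l) * (1 - ζ ^ (6 * k + 1)) = -(ζ ^ (3 * k) * (1 - ζ ^ (6 * l + 1))) := by
    have hk : ζ ^ (3 * l) * ζ ^ (6 * k + 1) = ζ ^ (3 * k) := by
      rw [← mul_one (ζ ^ (3 * k)), ← hr, ← hkl]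
      ring
    have hl : ζ ^ (3 * k) * ζ ^ (6 * l + 1) = ζ ^ (3 * l) := by
      rw [← mul_one (ζ ^ (3 * l)), ← hr, ← hkl]
      ring
    linear_combination -hk - hl
  refine mul_left_cancel₀ (pow_ne_zero (3 * k + 3 * l) hζ) ?_
  rw [summand, summand]
  linear_combination (1 - ζ)⁻¹ * (ζ ^ (2 * k) * pochRatio ζ 1 k ^ 2) ^ 3 * hlead -
    (1 - ζ)⁻¹ * ζ ^ (3 * k) * (1 - ζ ^ (6 * l + 1)) * hR

theorem sum_range_eq_zero_of_reflect [CharZero F] {f : ℕ → F}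
    (h : ∀ k l, k + l = r → f k = -f l) : ∑ k ∈ Finset.range (r + 1), f k = 0 := by
  rw [← self_eq_neg, ← Finset.sum_neg_distrib, ← Finset.sum_flip]
  refine Finset.sum_congr rfl fun k hk => ?_
  exact h _ _ (Nat.sub_add_cancel (Nat.lt_succ_iff.1 (Finset.mem_range.1 hk)))

end Reflection

section Value

variable {K L : Type*} [Field K] [Field L] [Algebra K L] {ζ z w : L} {A B : RatFunc K}

/-- The rational function `A` is regular at `ζ`, an element of an extension of the field of
coefficients, and takes the value `z` there. -/
def HasValueAt (ζ : L) (A : RatFunc K) (z : L) : Prop :=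
  ∃ a b : K[X], aeval ζ b ≠ 0 ∧ A * algebraMap K[X] (RatFunc K) b = algebraMap K[X] (RatFunc K) a ∧
    z * aeval ζ b = aeval ζ a

namespace HasValueAt

theorem of_algebraMap (ζ : L) (a : K[X]) :
    HasValueAt ζ (algebraMap K[X] (RatFunc K) a) (aeval ζ a) :=
  ⟨a, 1, by simp, by simp, by simp⟩

theorem one (ζ : L) : HasValueAt ζ (1 : RatFunc K) 1 := by
  simpa using of_algebraMap ζ (1 : K[X])

theorem X (ζ : L) : HasValueAt ζ (RatFunc.X : RatFunc K) ζ := by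
  simpa using of_algebraMap ζ (Polynomial.X : K[X])

theorem add (hA : HasValueAt ζ A z) (hB : HasValueAt ζ B w) : HasValueAt ζ (A + B) (z + w) := by
  obtain ⟨a, b, hb, h1, h2⟩ := hA
  obtain ⟨c, d, hd, h3, h4⟩ := hB
  refine ⟨a * d + c * b, b * d, by simp [hb, hd], ?_, ?_⟩ <;> simp only [map_add, map_mul]
  · linear_combination algebraMap K[X] _ d * h1 + algebraMap K[X] _ b * h3
  · linear_combination aeval ζ d * h2 + aeval ζ b * h4

theorem mul (hA : HasValueAt ζ A z) (hB : HasValueAt ζ B w) : HasValueAt ζ (A * B) (z * w) := by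
  obtain ⟨a, b, hb, h1, h2⟩ := hA
  obtain ⟨c, d, hd, h3, h4⟩ := hB
  refine ⟨a * c, b * d, by simp [hb, hd], ?_, ?_⟩ <;> simp only [map_mul, ← h1, ← h2, ← h3, ← h4]
    <;> ring

theorem neg (hA : HasValueAt ζ A z) : HasValueAt ζ (-A) (-z) := by
  obtain ⟨a, b, hb, h1, h2⟩ := hA
  exact ⟨-a, b, hb, by rw [map_neg, ← h1, neg_mul], by rw [map_neg, ← h2, neg_mul]⟩

theorem sub (hA : HasValueAt ζ A z) (hB : HasValueAt ζ B w) : HasValueAt ζ (A - B) (z - w) := by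
  simpa only [sub_eq_add_neg] using hA.add hB.neg

theorem ne_zero (hA : HasValueAt ζ A z) (hz : z ≠ 0) : A ≠ 0 := by
  obtain ⟨a, b, hb, h1, h2⟩ := hA
  rintro rfl
  rw [zero_mul, eq_comm, map_eq_zero_iff _ (RatFunc.algebraMap_injective K)] at h1
  exact mul_ne_zero hz hb (by rw [h2, h1, map_zero])

theorem inv (hA : HasValueAt ζ A z) (hz : z ≠ 0) : HasValueAt ζ A⁻¹ z⁻¹ := by
  have hA0 := hA.ne_zero hz
  obtain ⟨a, b, hb, h1, h2⟩ := hA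
  exact ⟨b, a, h2 ▸ mul_ne_zero hz hb, by rw [← h1, inv_mul_cancel_left₀ hA0],
    by rw [← h2, inv_mul_cancel_left₀ hz]⟩

theorem div (hA : HasValueAt ζ A z) (hB : HasValueAt ζ B w) (hw : w ≠ 0) :
    HasValueAt ζ (A / B) (z / w) := by
  simpa only [div_eq_mul_inv] using hA.mul (hB.inv hw)

theorem prod {ι : Type*} {s : Finset ι} {f : ι → RatFunc K} {g : ι → L}
    (h : ∀ i ∈ s, HasValueAt ζ (f i) (g i)) : HasValueAt ζ (∏ i ∈ s, f i) (∏ i ∈ s, g i) := by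
  classical
  induction s using Finset.induction_on with
  | empty => simpa using one ζ
  | insert i s hi ih =>
    rw [Finset.prod_insert hi, Finset.prod_insert hi]
    exact (h i (Finset.mem_insert_self i s)).mul
      (ih fun j hj => h j (Finset.mem_insert_of_mem hj))

theorem sum {ι : Type*} {s : Finset ι} {f : ι → RatFunc K} {g : ι → L}
    (h : ∀ i ∈ s, HasValueAt ζ (f i) (g i)) : HasValueAt ζ (∑ i ∈ s, f i) (∑ i ∈ s, g i) := by
  classical
  induction s using Finset.induction_on with
  | empty => simpa using of_algebraMap ζ (0 : K[X])
  | insert i s hi ih =>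
    rw [Finset.sum_insert hi, Finset.sum_insert hi]
    exact (h i (Finset.mem_insert_self i s)).add
      (ih fun j hj => h j (Finset.mem_insert_of_mem hj))

theorem pow (hA : HasValueAt ζ A z) (k : ℕ) : HasValueAt ζ (A ^ k) (z ^ k) := by
  simpa using prod (s := Finset.range k) fun _ _ => hA

theorem qPoch {x p : RatFunc K} (hx : HasValueAt ζ x z) (hp : HasValueAt ζ p w) (k : ℕ) :
    HasValueAt ζ (QSuper.qPoch x p k) (QSuper.qPoch z w k) :=
  prod fun i _ => (one ζ).sub (hx.mul (hp.pow i))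

theorem koebe (hA : HasValueAt ζ A z) (hz : z ≠ 1) :
    HasValueAt ζ (QSuper.koebe A) (QSuper.koebe z) :=
  hA.div (((one ζ).sub hA).pow 2) (pow_ne_zero 2 (sub_ne_zero.2 hz.symm))

theorem minpoly_pow_succ_dvd_num {f : K[X]} {k : ℕ} (hζ : IsIntegral K ζ) (hf0 : f ≠ 0)
    (hf : minpoly K ζ ^ k ∣ f) (h : HasValueAt ζ (A / algebraMap K[X] (RatFunc K) f) 0) :
    minpoly K ζ ^ (k + 1) ∣ A.num := by
  obtain ⟨a, b, hb, h1, h2⟩ := h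
  have ha : minpoly K ζ ∣ a := minpoly.dvd K ζ (by rw [← h2, zero_mul])
  have hf0' := (map_ne_zero_iff _ (RatFunc.algebraMap_injective K)).2 hf0
  have hd0 := (map_ne_zero_iff _ (RatFunc.algebraMap_injective K)).2 A.denom_ne_zero
  have hnum : A.num * b = f * a * A.denom := by
    apply RatFunc.algebraMap_injective K
    rw [div_mul_eq_mul_div, div_eq_iff hf0'] at h1
    rw [← A.num_div_denom, div_mul_eq_mul_div, div_eq_iff hd0] at h1
    simp only [map_mul]
    rw [h1, mul_comm (algebraMap K[X] _ f)]
  have hcop : IsCoprime (minpoly K ζ ^ (k + 1)) b :=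
    (((minpoly.irreducible hζ).coprime_iff_not_dvd).2 fun hdvd =>
      hb (by obtain ⟨c, rfl⟩ := hdvd; rw [map_mul, minpoly.aeval, zero_mul])).pow_left
  refine hcop.dvd_of_dvd_mul_right ?_
  rw [hnum, pow_succ]
  exact (mul_dvd_mul hf ha).mul_right _

end HasValueAt

end Value

namespace HasValueAt

variable {K L : Type*} [Field K] [Field L] [Algebra K L] {ζ p₀ x₀ y₀ : L} {p x y U : RatFunc K}
  {k : ℕ}

theorem koebeSum (hp : HasValueAt ζ p p₀) (hx : HasValueAt ζ x x₀) (hy : HasValueAt ζ y y₀)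
    (hx1 : ∀ i < k, x₀ * p₀ ^ i ≠ 1) (hy1 : ∀ i < k, y₀ * p₀ ^ i ≠ 1) :
    HasValueAt ζ (koebeSum p x y k) (QSuper.koebeSum p₀ x₀ y₀ k) :=
  sum fun i hi => ((hx.mul (hp.pow i)).koebe (hx1 i (Finset.mem_range.1 hi))).sub
    ((hy.mul (hp.pow i)).koebe (hy1 i (Finset.mem_range.1 hi)))

theorem exists_deform_second_order (hp : HasValueAt ζ p p₀) (hx : HasValueAt ζ x x₀)
    (hy : HasValueAt ζ y y₀) (hx1 : ∀ i < k, x₀ * p₀ ^ i ≠ 1) (hy1 : ∀ i < k, y₀ * p₀ ^ i ≠ 1)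
    (hU : HasValueAt ζ U 0) (hU0 : U ≠ 0) :
    ∃ e, HasValueAt ζ ((deform p x y U k - 1 - U * QSuper.koebeSum p x y k) / U ^ 2) e := by
  induction k with
  | zero => exact ⟨0, by simpa [deform, QSuper.koebeSum] using of_algebraMap ζ (0 : K[X])⟩
  | succ k ih =>
    obtain ⟨e, he⟩ := ih (fun i hi => hx1 i (hi.trans k.lt_succ_self))
      (fun i hi => hy1 i (hi.trans k.lt_succ_self))
    have hS := koebeSum hp hx hy (fun i hi => hx1 i (Nat.lt_succ_of_lt hi))
      (fun i hi => hy1 i (Nat.lt_succ_of_lt hi))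
    have ha := (hx.mul (hp.pow k)).koebe (hx1 k k.lt_succ_self)
    have hb := (hy.mul (hp.pow k)).koebe (hy1 k k.lt_succ_self)
    have hden := (one ζ).add (hU.mul hb)
    rw [zero_mul, add_zero] at hden
    have hden0 := hden.ne_zero one_ne_zero
    have h := ((he.mul ((one ζ).add (hU.mul ha))).add ((hS.sub hb).mul (ha.sub hb))).div hden
      one_ne_zero
    refine ⟨_, Eq.mpr (congrArg (HasValueAt ζ · _) ?_) h⟩
    rw [deform, Finset.prod_range_succ, ← deform, QSuper.koebeSum, Finset.sum_range_succ,
      ← QSuper.koebeSum]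
    generalize QSuper.koebe (y * p ^ k) = b at *
    field_simp
    ring

theorem deform_sub_one_div (hp : HasValueAt ζ p p₀) (hx : HasValueAt ζ x x₀)
    (hy : HasValueAt ζ y y₀) (hx1 : ∀ i < k, x₀ * p₀ ^ i ≠ 1) (hy1 : ∀ i < k, y₀ * p₀ ^ i ≠ 1)
    (hU : HasValueAt ζ U 0) (hU0 : U ≠ 0) :
    HasValueAt ζ ((deform p x y U k - 1) / U) (QSuper.koebeSum p₀ x₀ y₀ k) := by
  obtain ⟨e, he⟩ := exists_deform_second_order hp hx hy hx1 hy1 hU hU0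
  convert (koebeSum hp hx hy hx1 hy1).add (hU.mul he) using 1
  · field_simp
    ring
  · ring

end HasValueAt

theorem q_pow_injective : Function.Injective fun k : ℕ => q ^ k := fun a b h => by
  refine pow_right_injective₀ (M₀ := ℕ) two_pos (by norm_num) ?_
  have h' : (X : ℚ[X]) ^ a = X ^ b :=
    RatFunc.algebraMap_injective ℚ (by simpa only [map_pow, RatFunc.algebraMap_X, q] using h)
  simpa using congrArg (eval (2 : ℚ)) h'

theorem one_sub_q_pow_ne_zero {a : ℕ} (ha : a ≠ 0) : 1 - q ^ a ≠ 0 :=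
  sub_ne_zero.2 fun h => ha (q_pow_injective ((pow_zero q).trans h)).symm

theorem one_sub_q_ne_zero : 1 - q ≠ 0 := pow_one q ▸ one_sub_q_pow_ne_zero one_ne_zero

theorem not_dvd_three_mul {d i : ℕ} (h3 : d.Coprime 3) (hi : i + 1 < d) : ¬d ∣ 3 * (i + 1) :=
  fun h => Nat.not_dvd_of_pos_of_lt i.succ_pos hi (h3.dvd_of_dvd_mul_left h)

theorem exists_dvd_three_mul_add {d : ℕ} (hd : d ≠ 0) (h3 : d.Coprime 3) (a : ℕ) :
    ∃ i < d, d ∣ 3 * i + a := by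
  have : NeZero d := ⟨hd⟩
  have h : ((3 : ℕ) : ZMod d) * ((3 : ℕ) : ZMod d)⁻¹ = 1 := ZMod.coe_mul_inv_eq_one 3 h3.symm
  refine ⟨(-((3 : ℕ) : ZMod d)⁻¹ * a).val, ZMod.val_lt _, ?_⟩
  rw [← ZMod.natCast_eq_zero_iff, Nat.cast_add, Nat.cast_mul, ZMod.natCast_zmod_val]
  linear_combination -(a : ZMod d) * h

section RootOfUnity

variable {F : Type*} [Field F] {ζ : F} {d k r s : ℕ}

theorem one_sub_ne_zero_of_one_lt (hd : 1 < d) (hζ : IsPrimitiveRoot ζ d) : 1 - ζ ≠ 0 :=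
  sub_ne_zero.2 (hζ.ne_one hd).symm

theorem qPoch_cube_ne_zero (hζ : IsPrimitiveRoot ζ d) (h3 : d.Coprime 3) (hs : s < d) :
    qPoch (ζ ^ 3) (ζ ^ 3) s ≠ 0 := by
  refine qPoch_ne_zero fun i hi => ?_
  rw [← pow_succ', ← pow_mul, Ne, hζ.pow_eq_one_iff_dvd]
  exact not_dvd_three_mul h3 (by omega)

theorem summand_eq_zero (hr : ζ ^ (3 * r + 1) = 1) (hrk : r < k) : summand ζ k = 0 := by
  rw [summand, pochRatio, qPoch_eq_zero hrk (by rw [← pow_mul, ← pow_add, add_comm, hr])]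
  simp

theorem sum_range_summand_eq_zero [CharZero F] (hζ : IsPrimitiveRoot ζ d) (h3 : d.Coprime 3)
    (hr : d ∣ 3 * r + 1) (hrs : r < s) (hs : s ≤ d) : ∑ i ∈ Finset.range s, summand ζ i = 0 := by
  have hr1 : ζ ^ (3 * r + 1) = 1 := (hζ.pow_eq_one_iff_dvd _).2 hr
  rw [← Finset.sum_subset (Finset.range_subset_range.2 hrs) fun i _ hi =>
    summand_eq_zero hr1 (by simpa using hi)]
  exact sum_range_eq_zero_of_reflect fun k l =>
    summand_reflect hr1 (qPoch_cube_ne_zero hζ h3 (hrs.trans_le hs))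

variable [CharZero F]

theorem hasValueAt_q (ζ : F) : HasValueAt ζ q ζ := HasValueAt.X ζ

theorem hasValueAt_q_pow (ζ : F) (a : ℕ) : HasValueAt ζ (q ^ a) (ζ ^ a) := (hasValueAt_q ζ).pow a

theorem hasValueAt_one_sub_q_pow_of_dvd (hζ : IsPrimitiveRoot ζ d) {a : ℕ} (ha : d ∣ a) :
    HasValueAt ζ (1 - q ^ a) 0 := by
  simpa [(hζ.pow_eq_one_iff_dvd a).2 ha] using (HasValueAt.one ζ).sub (hasValueAt_q_pow ζ a)

theorem exists_hasValueAt_one_sub_div_one_sub (hζ : IsPrimitiveRoot ζ d) {a b : ℕ} (ha : d ∣ a)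
    (hb : d ∣ b) (hb0 : b ≠ 0) : ∃ v, HasValueAt ζ ((1 - q ^ a) / (1 - q ^ b)) v := by
  obtain ⟨α, rfl⟩ := ha
  obtain ⟨β, rfl⟩ := hb
  have geom (α : ℕ) : HasValueAt ζ (∑ i ∈ Finset.range α, (q ^ d) ^ i) α := by
    simpa [hζ.pow_eq_one] using
      HasValueAt.sum (s := Finset.range α) fun i _ => (hasValueAt_q_pow ζ d).pow i
  rw [pow_mul, pow_mul, ← geom_sum_mul_neg (q ^ d) α, ← geom_sum_mul_neg (q ^ d) β,
    mul_div_mul_right _ _ (one_sub_q_pow_ne_zero (left_ne_zero_of_mul hb0))]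
  exact ⟨_, (geom α).div (geom β) (Nat.cast_ne_zero.2 (right_ne_zero_of_mul hb0))⟩

/-- Each of the two products of `d` factors vanishes exactly once at `ζ`. -/
theorem exists_hasValueAt_qPoch_div_qPoch (hζ : IsPrimitiveRoot ζ d) (h3 : d.Coprime 3) (a : ℕ)
    {b : ℕ} (hb : d ∣ b) :
    ∃ v, HasValueAt ζ (qPoch (q ^ a) (q ^ 3) d / qPoch (q ^ (3 + b)) (q ^ 3) d) v := by
  obtain rfl | ⟨e, rfl⟩ : d = 0 ∨ ∃ e, d = e + 1 := by cases d <;> simp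
  · exact ⟨1, by simpa [qPoch_zero] using HasValueAt.one ζ⟩
  obtain ⟨i, hi, hdvd⟩ := exists_dvd_three_mul_add e.succ_ne_zero h3 a
  have hb1 : ζ ^ b = 1 := (hζ.pow_eq_one_iff_dvd b).2 hb
  obtain ⟨v, hv⟩ := exists_hasValueAt_one_sub_div_one_sub hζ hdvd
    (b := 3 * (e + 1) + b) (dvd_add (dvd_mul_left _ _) hb) (by omega)
  have hnum := HasValueAt.prod (s := (Finset.range (e + 1)).erase i) fun j _ =>
    (HasValueAt.one ζ).sub ((hasValueAt_q_pow ζ a).mul ((hasValueAt_q_pow ζ 3).pow j))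
  have hden := (hasValueAt_q_pow ζ (3 + b)).qPoch (hasValueAt_q_pow ζ 3) e
  rw [pow_add ζ, hb1, mul_one] at hden
  refine ⟨_, Eq.mpr (congrArg (HasValueAt ζ · _) ?_)
    (hv.mul (hnum.div hden (qPoch_cube_ne_zero hζ h3 e.lt_succ_self)))⟩
  rw [← mul_prod_erase_eq_qPoch _ _ hi, qPoch_succ, div_mul_div_comm, mul_comm (qPoch _ _ e)]
  ring

theorem hasValueAt_pochRatio (hζ : IsPrimitiveRoot ζ d) (h3 : d.Coprime 3) (a : ℕ) (hs : s < d) :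
    HasValueAt ζ (pochRatio q a s) (pochRatio ζ a s) :=
  ((hasValueAt_q_pow ζ a).qPoch (hasValueAt_q_pow ζ 3) s).div
    ((hasValueAt_q_pow ζ 3).qPoch (hasValueAt_q_pow ζ 3) s) (qPoch_cube_ne_zero hζ h3 hs)

theorem pochRatio_add {K : Type*} [Field K] (t : K) (a k l : ℕ) :
    pochRatio t a (k + l) = pochRatio t a k *
      (qPoch (t ^ (a + 3 * k)) (t ^ 3) l / qPoch (t ^ (3 + 3 * k)) (t ^ 3) l) := by
  rw [pochRatio, qPoch_add, qPoch_add, mul_div_mul_comm, ← pochRatio, ← pow_mul, ← pow_add,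
    ← pow_add]

theorem exists_hasValueAt_pochRatio_mul (hζ : IsPrimitiveRoot ζ d) (h3 : d.Coprime 3) (a l : ℕ) :
    ∃ v, HasValueAt ζ (pochRatio q a (l * d)) v := by
  induction l with
  | zero => exact ⟨1, by simpa [pochRatio, qPoch_zero] using HasValueAt.one ζ⟩
  | succ l ih =>
    obtain ⟨v, hv⟩ := ih
    obtain ⟨w, hw⟩ := exists_hasValueAt_qPoch_div_qPoch hζ h3 (a + 3 * (l * d))
      (b := 3 * (l * d)) ((dvd_mul_left d l).mul_left 3)
    exact ⟨v * w, by rw [Nat.succ_mul, pochRatio_add]; exact hv.mul hw⟩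

theorem exists_hasValueAt_pochRatio_mul_add (hζ : IsPrimitiveRoot ζ d) (h3 : d.Coprime 3)
    (a l : ℕ) : ∃ v, ∀ s < d, HasValueAt ζ (pochRatio q a (l * d + s)) (v * pochRatio ζ a s) := by
  obtain ⟨v, hv⟩ := exists_hasValueAt_pochRatio_mul hζ h3 a l
  have hper (b : ℕ) : ζ ^ (b + 3 * (l * d)) = ζ ^ b := by
    rw [pow_add, (hζ.pow_eq_one_iff_dvd _).2 ((dvd_mul_left d l).mul_left 3), mul_one]
  have hPoch (b s : ℕ) := hper b ▸
    (hasValueAt_q_pow ζ (b + 3 * (l * d))).qPoch (hasValueAt_q_pow ζ 3) s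
  refine ⟨v, fun s hs => ?_⟩
  rw [pochRatio_add]
  exact hv.mul ((hPoch a s).div (hPoch 3 s) (qPoch_cube_ne_zero hζ h3 hs))

theorem hasValueAt_summand (hd : 1 < d) (hζ : IsPrimitiveRoot ζ d) {v : F}
    (h : HasValueAt ζ (pochRatio q 1 k) v) :
    HasValueAt ζ (summand q k) ((1 - ζ ^ (6 * k + 1)) / (1 - ζ) * v ^ 6 * ζ ^ (3 * k)) :=
  ((((HasValueAt.one ζ).sub (hasValueAt_q_pow ζ (6 * k + 1))).div
    ((HasValueAt.one ζ).sub (hasValueAt_q ζ)) (one_sub_ne_zero_of_one_lt hd hζ)).mul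
    (h.pow 6)).mul (hasValueAt_q_pow ζ (3 * k))

theorem exists_hasValueAt_summand_mul_add (hd : 1 < d) (hζ : IsPrimitiveRoot ζ d)
    (h3 : d.Coprime 3) (l : ℕ) :
    ∃ v, ∀ s < d, HasValueAt ζ (summand q (l * d + s)) (v * summand ζ s) := by
  obtain ⟨v, hv⟩ := exists_hasValueAt_pochRatio_mul_add hζ h3 1 l
  refine ⟨v ^ 6, fun s hs => ?_⟩
  have hper (a b : ℕ) : ζ ^ (a * (l * d + s) + b) = ζ ^ (a * s + b) := by
    rw [mul_add, add_assoc, pow_add,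
      (hζ.pow_eq_one_iff_dvd _).2 ((dvd_mul_left d l).mul_left a), one_mul]
  convert hasValueAt_summand hd hζ (hv s hs) using 1
  rw [hper, show ζ ^ (3 * (l * d + s)) = ζ ^ (3 * s) from hper 3 0, summand]
  ring

theorem hasValueAt_sum_block (hd : 1 < d) (hζ : IsPrimitiveRoot ζ d) (h3 : d.Coprime 3)
    (hr : d ∣ 3 * r + 1) (l : ℕ) (hrs : r < s) (hs : s ≤ d) :
    HasValueAt ζ (∑ i ∈ Finset.range s, summand q (l * d + i)) 0 := by
  obtain ⟨v, hv⟩ := exists_hasValueAt_summand_mul_add hd hζ h3 l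
  have h := HasValueAt.sum fun i hi => hv i ((Finset.mem_range.1 hi).trans_le hs)
  rwa [← Finset.mul_sum, sum_range_summand_eq_zero hζ h3 hr hrs hs, mul_zero] at h

theorem hasValueAt_sum_blocks (hd : 1 < d) (hζ : IsPrimitiveRoot ζ d) (h3 : d.Coprime 3)
    (hr : d ∣ 3 * r + 1) (hrd : r < d) (l : ℕ) :
    HasValueAt ζ (∑ i ∈ Finset.range (l * d), summand q i) 0 := by
  induction l with
  | zero => simpa using HasValueAt.of_algebraMap ζ (0 : ℚ[X])
  | succ l ih =>
    rw [Nat.succ_mul, Finset.sum_range_add]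
    simpa using ih.add (hasValueAt_sum_block hd hζ h3 hr l hrd le_rfl)

variable {m M : ℕ}

theorem coprime_three_of_dvd (hdm : d ∣ 3 * m + 1) : d.Coprime 3 :=
  Nat.Coprime.coprime_dvd_left hdm (by simp)

theorem hasValueAt_sum_summand (hd : 1 < d) (hζ : IsPrimitiveRoot ζ d) (hdm : d ∣ 3 * m + 1)
    (hM : M = m ∨ M = 3 * m) : HasValueAt ζ (∑ k ∈ Finset.range (M + 1), summand q k) 0 := by
  have h3 := coprime_three_of_dvd hdm
  have hrd : m % d < d := Nat.mod_lt m (by omega)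
  have hr : d ∣ 3 * (m % d) + 1 := by
    rw [← Nat.div_add_mod m d, mul_add, mul_left_comm, add_assoc] at hdm
    exact (Nat.dvd_add_right (dvd_mul_right _ _)).1 hdm
  rcases hM with rfl | rfl
  · rw [← Nat.div_add_mod' M d, add_assoc, Finset.sum_range_add]
    simpa using (hasValueAt_sum_blocks hd hζ h3 hr hrd (M / d)).add
      (hasValueAt_sum_block hd hζ h3 hr (M / d) (Nat.lt_succ_self _) hrd)
  · obtain ⟨e, he⟩ := hdm
    rw [he, mul_comm]
    exact hasValueAt_sum_blocks hd hζ h3 hr hrd e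

end RootOfUnity

/-- The rational function to which the truncated series is congruent, at an arbitrary point `t` of
a field. -/
def closedForm {K : Type*} [Field K] (t : K) (m : ℕ) : K :=
  (1 - t ^ (3 * m + 1)) / (1 - t) * pochRatio t 2 m ^ 3 *
    (1 + (1 - t ^ (3 * m + 1)) ^ 2 * (2 - t ^ (3 * m + 1)) * koebeSum (t ^ 3) (t ^ 2) (t ^ 3) m)

section ClosedForm

variable {F : Type*} [Field F] [CharZero F] {ζ : F} {d m n : ℕ}

theorem exists_hasValueAt_sq_mul_koebe (hζ : IsPrimitiveRoot ζ d) (hn : d ∣ n) {j : ℕ}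
    (hj : j ≠ 0) : ∃ v, HasValueAt ζ ((1 - q ^ n) ^ 2 * koebe (q ^ j)) v := by
  by_cases hdj : d ∣ j
  · obtain ⟨v, hv⟩ := exists_hasValueAt_one_sub_div_one_sub hζ hn hdj hj
    refine ⟨_, Eq.mpr (congrArg (HasValueAt ζ · _) ?_) ((hv.pow 2).mul (hasValueAt_q_pow ζ j))⟩
    rw [koebe, div_pow, mul_div_assoc', div_mul_eq_mul_div]
  · have hj1 : ζ ^ j ≠ 1 := fun h => hdj ((hζ.pow_eq_one_iff_dvd j).1 h)
    exact ⟨_, ((hasValueAt_one_sub_q_pow_of_dvd hζ hn).pow 2).mul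
      ((hasValueAt_q_pow ζ j).koebe hj1)⟩

theorem exists_hasValueAt_sq_mul_koebeSum (hζ : IsPrimitiveRoot ζ d) (hn : d ∣ n) (m : ℕ) :
    ∃ v, HasValueAt ζ ((1 - q ^ n) ^ 2 * koebeSum (q ^ 3) (q ^ 2) (q ^ 3) m) v := by
  choose v hv using fun i => exists_hasValueAt_sq_mul_koebe hζ hn (j := 3 * i + 2) (by omega)
  choose w hw using fun i => exists_hasValueAt_sq_mul_koebe hζ hn (j := 3 * i + 3) (by omega)
  refine ⟨_, Eq.mpr (congrArg (HasValueAt ζ · _) ?_)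
    (HasValueAt.sum (s := Finset.range m) fun i _ => (hv i).sub (hw i))⟩
  simp only [koebeSum, Finset.mul_sum, mul_sub, ← pow_mul, ← pow_add, add_comm]

theorem hasValueAt_closedForm (hd : 1 < d) (hζ : IsPrimitiveRoot ζ d) (hdm : d ∣ 3 * m + 1) :
    HasValueAt ζ (closedForm q m) 0 := by
  have h3 := coprime_three_of_dvd hdm
  obtain ⟨v, hv⟩ := exists_hasValueAt_pochRatio_mul_add hζ h3 2 (m / d)
  obtain ⟨w, hw⟩ := exists_hasValueAt_sq_mul_koebeSum hζ hdm m
  have hρ := hv (m % d) (Nat.mod_lt m (by omega))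
  rw [Nat.div_add_mod'] at hρ
  have h1 := (HasValueAt.one ζ).sub (hasValueAt_q ζ)
  have h2 := (HasValueAt.of_algebraMap ζ (2 : ℚ[X])).sub (hasValueAt_q_pow ζ (3 * m + 1))
  convert ((((hasValueAt_one_sub_q_pow_of_dvd hζ hdm).div h1
    (one_sub_ne_zero_of_one_lt hd hζ)).mul (hρ.pow 3)).mul
    ((HasValueAt.one ζ).add (h2.mul hw))) using 1
  · rw [closedForm, map_ofNat]
    ring
  · rw [zero_div, zero_mul, zero_mul]

end ClosedForm

section TopCyclotomic

theorem pairParam_eq {K : Type*} [Field K] {u : K} (hu : u ≠ 0) :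
    pairParam u = -((1 - u) ^ 2 / u) := by
  rw [pairParam]
  field_simp
  ring

theorem sum_summand_sub_closedForm_div {K : Type*} [Field K] {t Q V : K}
    (ht : Function.Injective fun k : ℕ => t ^ k) {m : ℕ} (hQ : t ^ (3 * m + 1) = Q)
    (hV : pairParam Q = V) :
    (∑ k ∈ Finset.range (m + 1), summand t k - closedForm t m) / (1 - Q) ^ 4 =
      (1 - Q) / (1 - t) * pochRatio t 2 m ^ 3 *
          (koebeSum (t ^ 3) (t ^ 2) (t ^ 3) m / Q -
            (deform (t ^ 3) (t ^ 2) (t ^ 3) V m - 1 - V * koebeSum (t ^ 3) (t ^ 2) (t ^ 3) m) /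
              V ^ 2 / Q ^ 2) +
        (∑ k ∈ Finset.range (m + 1), summand t k *
          ((deform (t ^ 3) t (t ^ 3) V k - 1) / V) ^ 2) / Q ^ 2 := by
  have hQ0 : Q ≠ 0 := hQ ▸ pow_ne_zero _ (ne_zero_of_pow_injective ht)
  have hQ1 : 1 - Q ≠ 0 := sub_ne_zero.2 fun h => absurd (ht ((pow_zero t).trans (h.trans hQ.symm)))
    (by omega)
  simp only [div_pow, mul_div_assoc', ← Finset.sum_div]
  rw [sum_summand ht, closedForm, hQ, hV]
  generalize ∑ k ∈ Finset.range (m + 1), summand t k * (deform (t ^ 3) t (t ^ 3) V k - 1) ^ 2 = Ω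
  generalize deform (t ^ 3) (t ^ 2) (t ^ 3) V m = D
  rw [← hV, pairParam_eq hQ0, div_eq_iff (pow_ne_zero 4 hQ1), div_eq_mul_inv (1 - Q) (1 - t)]
  field_simp
  ring

variable {F : Type*} [Field F] {ζ : F} {k m M : ℕ}

theorem pow_mul_cube_pow_ne_one (hζ : IsPrimitiveRoot ζ (3 * m + 1)) {a : ℕ} (ha : 0 < a)
    (ha3 : a ≤ 3) (hk : k ≤ m) : ∀ i < k, ζ ^ a * (ζ ^ 3) ^ i ≠ 1 := fun i hi => by
  rw [← pow_mul, ← pow_add]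
  exact hζ.pow_ne_one_of_pos_of_lt (by omega) (by omega)

variable [CharZero F]

theorem pairParam_q_pow_ne_zero (m : ℕ) : pairParam (q ^ (3 * m + 1)) ≠ 0 := by
  rw [pairParam_eq (pow_ne_zero _ (ne_zero_of_pow_injective q_pow_injective))]
  exact neg_ne_zero.2 (div_ne_zero (pow_ne_zero 2 (one_sub_q_pow_ne_zero (by omega)))
    (pow_ne_zero _ (ne_zero_of_pow_injective q_pow_injective)))

theorem hasValueAt_pairParam (hζ : IsPrimitiveRoot ζ (3 * m + 1)) :
    HasValueAt ζ (pairParam (q ^ (3 * m + 1))) 0 := by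
  rw [pairParam_eq (pow_ne_zero _ (ne_zero_of_pow_injective q_pow_injective))]
  convert (((hasValueAt_one_sub_q_pow_of_dvd hζ dvd_rfl).pow 2).div (hasValueAt_q_pow ζ _)
    (pow_ne_zero _ (hζ.ne_zero (by omega)))).neg using 1
  simp

/-- The `k`-th term is the product of an antisymmetric and a symmetric function of `k ↦ m - k`. -/
theorem hasValueAt_sum_summand_mul_sq (hm : m ≠ 0) (hζ : IsPrimitiveRoot ζ (3 * m + 1)) :
    HasValueAt ζ (∑ k ∈ Finset.range (m + 1), summand q k *
      ((deform (q ^ 3) q (q ^ 3) (pairParam (q ^ (3 * m + 1))) k - 1) /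
        pairParam (q ^ (3 * m + 1))) ^ 2) 0 := by
  have hm1 := hζ.pow_eq_one
  have hc : (3 * m + 1).Coprime 3 := coprime_three_of_dvd dvd_rfl
  have h0 := qPoch_cube_ne_zero hζ hc (s := m) (by omega)
  rw [← sum_range_eq_zero_of_reflect (r := m)
    (f := fun k => summand ζ k * koebeSum (ζ ^ 3) ζ (ζ ^ 3) k ^ 2)
    fun k l hkl => by rw [summand_reflect hm1 h0 hkl, koebeSum_reflect hm1 hkl, neg_mul]]
  refine HasValueAt.sum fun k hk => ?_
  have hk : k ≤ m := Nat.lt_succ_iff.1 (Finset.mem_range.1 hk)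
  exact (hasValueAt_summand (by omega) hζ (hasValueAt_pochRatio hζ hc 1 (by omega))).mul
    ((HasValueAt.deform_sub_one_div (hasValueAt_q_pow ζ 3) (hasValueAt_q ζ) (hasValueAt_q_pow ζ 3)
      (by simpa using pow_mul_cube_pow_ne_one hζ one_pos (by norm_num) hk)
      (pow_mul_cube_pow_ne_one hζ three_pos le_rfl hk) (hasValueAt_pairParam hζ)
      (pairParam_q_pow_ne_zero m)).pow 2)

theorem hasValueAt_sum_summand_sub_closedForm_div (hm : m ≠ 0)
    (hζ : IsPrimitiveRoot ζ (3 * m + 1)) :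
    HasValueAt ζ ((∑ k ∈ Finset.range (m + 1), summand q k - closedForm q m) /
      (1 - q ^ (3 * m + 1)) ^ 4) 0 := by
  have hζ0 : ζ ^ (3 * m + 1) ≠ 0 := pow_ne_zero _ (hζ.ne_zero (by omega))
  have hQ := hasValueAt_q_pow ζ (3 * m + 1)
  have h2 := pow_mul_cube_pow_ne_one hζ two_pos (by norm_num) (le_refl m)
  have h3 := pow_mul_cube_pow_ne_one hζ three_pos le_rfl (le_refl m)
  obtain ⟨e, he⟩ := HasValueAt.exists_deform_second_order (hasValueAt_q_pow ζ 3)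
    (hasValueAt_q_pow ζ 2) (hasValueAt_q_pow ζ 3) h2 h3 (hasValueAt_pairParam hζ)
    (pairParam_q_pow_ne_zero m)
  have hH := HasValueAt.koebeSum (hasValueAt_q_pow ζ 3) (hasValueAt_q_pow ζ 2)
    (hasValueAt_q_pow ζ 3) h2 h3
  have hA := ((hasValueAt_one_sub_q_pow_of_dvd hζ dvd_rfl).div ((HasValueAt.one ζ).sub
    (hasValueAt_q ζ)) (one_sub_ne_zero_of_one_lt (by omega) hζ)).mul
    ((hasValueAt_pochRatio hζ (coprime_three_of_dvd dvd_rfl) 2 (s := m) (by omega)).pow 3)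
  rw [sum_summand_sub_closedForm_div q_pow_injective rfl rfl]
  simpa using (hA.mul ((hH.div hQ hζ0).sub (he.div (hQ.pow 2) (pow_ne_zero 2 hζ0)))).add
    ((hasValueAt_sum_summand_mul_sq hm hζ).div (hQ.pow 2) (pow_ne_zero 2 hζ0))

theorem hasValueAt_summand_div (hζ : IsPrimitiveRoot ζ (3 * m + 1)) (hmk : m < k)
    (hk : k ≤ 3 * m) : HasValueAt ζ (summand q k / (1 - q ^ (3 * m + 1)) ^ 4) 0 := by
  have hN : 1 - q ^ (3 * m + 1) ≠ 0 := one_sub_q_pow_ne_zero (by omega)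
  have hnum := HasValueAt.prod (s := (Finset.range k).erase m) fun i _ =>
    (HasValueAt.one ζ).sub ((hasValueAt_q ζ).mul ((hasValueAt_q_pow ζ 3).pow i))
  have hden := (hasValueAt_q_pow ζ 3).qPoch (hasValueAt_q_pow ζ 3) k
  have hden0 := qPoch_cube_ne_zero hζ (coprime_three_of_dvd dvd_rfl) (s := k) (by omega)
  have h := (((((HasValueAt.one ζ).sub (hasValueAt_q_pow ζ (6 * k + 1))).div
    ((HasValueAt.one ζ).sub (hasValueAt_q ζ)) (one_sub_ne_zero_of_one_lt (by omega) hζ)).mul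
    ((hnum.div hden hden0).pow 6)).mul (hasValueAt_q_pow ζ (3 * k))).mul
    ((hasValueAt_one_sub_q_pow_of_dvd hζ dvd_rfl).pow 2)
  rw [zero_pow two_ne_zero, mul_zero] at h
  refine Eq.mpr (congrArg (HasValueAt ζ · _) ?_) h
  rw [summand, pochRatio, pow_one, ← mul_prod_erase_eq_qPoch _ _ hmk, ← pow_mul, ← pow_succ',
    div_eq_iff (pow_ne_zero 4 hN)]
  ring

theorem hasValueAt_sum_summand_sub_closedForm_div_of_le (hm : m ≠ 0)
    (hζ : IsPrimitiveRoot ζ (3 * m + 1)) (hmM : m ≤ M) (hM : M ≤ 3 * m) :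
    HasValueAt ζ ((∑ k ∈ Finset.range (M + 1), summand q k - closedForm q m) /
      (1 - q ^ (3 * m + 1)) ^ 4) 0 := by
  induction M, hmM using Nat.le_induction with
  | base => exact hasValueAt_sum_summand_sub_closedForm_div hm hζ
  | succ M hmM ih =>
    rw [Finset.sum_range_succ, add_sub_right_comm, add_div]
    simpa using (ih (by omega)).add (hasValueAt_summand_div hζ (by omega) hM)

end TopCyclotomic

section Congruence

variable {d m n M : ℕ}

theorem qIntPoly_mul_cyclotomic_pow_dvd {P : ℚ[X]} (hn : 1 < n) (k : ℕ)
    (hP : ∀ d, d ∣ n → 1 < d → cyclotomic d ℚ ∣ P) (hPn : cyclotomic n ℚ ^ (k + 1) ∣ P) :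
    qIntPoly n * cyclotomic n ℚ ^ k ∣ P := by
  have hmem : n ∈ n.divisors.erase 1 := by simp [hn.ne', (zero_lt_one.trans hn).ne']
  rw [qIntPoly, ← prod_cyclotomic_eq_geom_sum (by omega) ℚ, ← Finset.mul_prod_erase _ _ hmem,
    mul_right_comm, ← pow_succ']
  refine (IsCoprime.prod_right fun d hd => ?_).pow_left.mul_dvd hPn
    (Finset.prod_dvd_of_coprime (fun a _ b _ hab => cyclotomic.isCoprime_rat hab) fun d hd => ?_)
  · exact cyclotomic.isCoprime_rat (Finset.ne_of_mem_erase hd).symm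
  · obtain ⟨hd1, hd⟩ := Finset.mem_erase.1 (Finset.mem_of_mem_erase hd)
    have := Nat.pos_of_mem_divisors hd
    exact hP d (Nat.dvd_of_mem_divisors hd) (by omega)

theorem cyclotomic_pow_succ_dvd_num_of_hasValueAt (hn : 0 < n) (k : ℕ) {A : RatFunc ℚ}
    (h : ∀ ζ : ℂ, IsPrimitiveRoot ζ n → HasValueAt ζ (A / (1 - q ^ n) ^ k) 0) :
    cyclotomic n ℚ ^ (k + 1) ∣ A.num := by
  have hζ := Complex.isPrimitiveRoot_exp n hn.ne'
  have hf : cyclotomic n ℚ ∣ 1 - X ^ n := (dvd_sub_comm).1 (cyclotomic.dvd_X_pow_sub_one n ℚ)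
  have hf0 : (1 - X ^ n : ℚ[X]) ≠ 0 :=
    sub_ne_zero.2 (sub_ne_zero.1 (X_pow_sub_C_ne_zero hn 1)).symm
  rw [cyclotomic_eq_minpoly_rat hζ hn] at hf ⊢
  exact HasValueAt.minpoly_pow_succ_dvd_num (hζ.isIntegral hn).tower_top (pow_ne_zero k hf0)
    (pow_dvd_pow_of_dvd hf k) (by simpa [q] using h _ hζ)

theorem ratCongr_sum_summand_closedForm (hM : M = m ∨ M = 3 * m) :
    RatCongr (qIntPoly (3 * m + 1) * cyclotomic (3 * m + 1) ℚ ^ 4)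
      (∑ k ∈ Finset.range (M + 1), summand q k) (closedForm q m) := by
  obtain rfl | hm := eq_or_ne m 0
  · obtain rfl : M = 0 := by omega
    simp [RatCongr, summand, closedForm, pochRatio, koebeSum, qPoch, one_sub_q_ne_zero]
  · refine qIntPoly_mul_cyclotomic_pow_dvd (by omega) 4 (fun d hdm hd => ?_) ?_
    · rw [← pow_one (cyclotomic d ℚ)]
      refine cyclotomic_pow_succ_dvd_num_of_hasValueAt (by omega) 0 fun ζ hζ => ?_
      simpa using (hasValueAt_sum_summand hd hζ hdm hM).sub (hasValueAt_closedForm hd hζ hdm)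
    · exact cyclotomic_pow_succ_dvd_num_of_hasValueAt (by omega) 4 fun ζ hζ =>
        hasValueAt_sum_summand_sub_closedForm_div_of_le hm hζ (by omega) (by omega)

theorem q_pow_div_qInt_sq (r : ℕ) : q ^ r / qInt r ^ 2 = (1 - q) ^ 2 * koebe (q ^ r) := by
  rw [qInt, koebe, div_pow, div_div_eq_mul_div, mul_comm, mul_div_assoc]

theorem sum_q_pow_div_qInt_sq (m : ℕ) :
    ∑ j ∈ Finset.Icc 1 m,
        (q ^ (3 * j - 1) / qInt (3 * j - 1) ^ 2 - q ^ (3 * j) / qInt (3 * j) ^ 2) =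
      (1 - q) ^ 2 * koebeSum (q ^ 3) (q ^ 2) (q ^ 3) m := by
  rw [← Finset.Ico_add_one_right_eq_Icc, Finset.sum_Ico_eq_sum_range, koebeSum, Finset.mul_sum]
  refine Finset.sum_congr rfl fun i _ => ?_
  rw [show 3 * (1 + i) - 1 = 2 + 3 * i by omega, mul_add, q_pow_div_qInt_sq, q_pow_div_qInt_sq,
    ← mul_sub]
  simp only [pow_add, pow_mul, mul_one]

theorem qInt_mul_qPoch_eq_summand (k : ℕ) :
    qInt (6 * k + 1) * (qPoch q (q ^ 3) k ^ 6 / qPoch (q ^ 3) (q ^ 3) k ^ 6) * q ^ (3 * k) =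
      summand q k := by
  rw [summand, pochRatio, qInt, pow_one, div_pow]

theorem qInt_mul_qPoch_eq_closedForm (m : ℕ) :
    qInt (3 * m + 1) * (qPoch (q ^ 2) (q ^ 3) m ^ 3 / qPoch (q ^ 3) (q ^ 3) m ^ 3) *
        (1 + qInt (3 * m + 1) ^ 2 * (2 - q ^ (3 * m + 1)) *
          ∑ j ∈ Finset.Icc 1 m,
            (q ^ (3 * j - 1) / qInt (3 * j - 1) ^ 2 - q ^ (3 * j) / qInt (3 * j) ^ 2)) =
      closedForm q m := by
  have h : qInt (3 * m + 1) ^ 2 * (1 - q) ^ 2 = (1 - q ^ (3 * m + 1)) ^ 2 := by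
    rw [qInt, ← mul_pow, div_mul_cancel₀ _ one_sub_q_ne_zero]
  rw [sum_q_pow_div_qInt_sq, ← div_pow, closedForm, pochRatio, ← h, qInt]
  ring

end Congruence

end QSuper

open QSuper in
theorem theorem1p2 (n : ℕ) (hn : 0 < n) (hn3 : n ≡ 1 [MOD 3])
    (M : ℕ) (hM : M = (n - 1) / 3 ∨ M = n - 1) :
    RatCongr (qIntPoly n * Polynomial.cyclotomic n ℚ ^ 4)
      (∑ k ∈ Finset.range (M + 1),
        qInt (6 * k + 1) * (qPoch q (q ^ 3) k ^ 6 / qPoch (q ^ 3) (q ^ 3) k ^ 6) * q ^ (3 * k))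
      (qInt n *
        (qPoch (q ^ 2) (q ^ 3) ((n - 1) / 3) ^ 3 / qPoch (q ^ 3) (q ^ 3) ((n - 1) / 3) ^ 3) *
        (1 + qInt n ^ 2 * (2 - q ^ n) *
          ∑ j ∈ Finset.Icc 1 ((n - 1) / 3),
            (q ^ (3 * j - 1) / qInt (3 * j - 1) ^ 2 - q ^ (3 * j) / qInt (3 * j) ^ 2))) := by
  obtain ⟨m, rfl⟩ : ∃ m, n = 3 * m + 1 := ⟨n / 3, by rw [Nat.ModEq] at hn3; omega⟩
  have hm : (3 * m + 1 - 1) / 3 = m := by omega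
  rw [hm, qInt_mul_qPoch_eq_closedForm, Finset.sum_congr rfl fun k _ => qInt_mul_qPoch_eq_summand k]
  exact ratCongr_sum_summand_closedForm (by omega)
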